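/- For a group $G$ let $\mathrm{Ab}(G)$ be its abelianization, $\mathrm{Tor}(G)$ the (normal) subgroup generated by all elements of finite order, and $F(G)=G/\mathrm{Tor}(G)$. For a prime $p$, call $G$ \emph{divisible by $p$} if the map $x\mapsto x^p$ on $G$ is surjective, and \emph{$\bar p$-local} (uniquely $p$-divisible) if this map is bijective. The \emph{Bockstein groups} (considered up to isomorphism) are $\mathbf Q$ and, for every prime $p$, $\mathbf Z/p$, $\mathbf Z/p^\infty$ and $\mathbf Z_{(p)}=\{\frac mn\in\mathbf Q : p\nmid n\}$. The \emph{Bockstein basis} $\sigma(G)$ of a nilpotent group $G$ is the set of Bockstein groups determined by the following conditions, for all primes $p$: \begin{enumerate} \item $\mathbf Q\notin\sigma(G)$ if and only if $G=\mathrm{Tor}(G)$; \item $\mathbf Z/p^\infty\notin\sigma(G)$ if and only if $G$ is $\bar p$-local; \item $\mathbf Z/p\notin\sigma(G)$ if and only if $G$ is divisible by $p$; \item $\mathbf Z_{(p)}\notin\sigma(G)$ if and only if $F(G)$ is $\bar p$-local. \end{enumerate} Let $\sigma_{TD}(G)$ be the set of all $\mathbf Z/p^\infty$, $p$ prime, that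 belong to $\sigma(G)$, and let $\sigma_{NTD}(G)=\sigma(G)\setminus\sigma_{TD}(G)$. Then for every nilpotent group $G$, $$\sigma_{NTD}(G)=\sigma_{NTD}(\mathrm{Ab}(G))\qquad\text{and}\qquad \sigma(\mathrm{Ab}(G))\subset\sigma(G).$$ -/

import Mathlib

/-- `Tor(G)`: the subgroup generated by the torsion elements of `G`. -/
def torSubgroup (G : Type*) [Group G] : Subgroup G :=
  Subgroup.closure {g : G | IsOfFinOrder g}

instance torSubgroup_normal (G : Type*) [Group G] : (torSubgroup G).Normal where
  conj_mem n hn g := by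
    have h : torSubgroup G ≤ (torSubgroup G).comap (MulAut.conj g).toMonoidHom :=
      (Subgroup.closure_le _).2 fun x hx =>
        Subgroup.subset_closure ((MulAut.conj g).toMonoidHom.isOfFinOrder hx)
    exact h hn

/-- `F(G) = G / Tor(G)`. -/
abbrev torFreeQuotient (G : Type*) [Group G] : Type _ := G ⧸ torSubgroup G

/-- `G` is divisible by `p`: every element has a `p`-th root. -/
def IsDivisibleBy (p : ℕ) (G : Type*) [Group G] : Prop :=
  Function.Surjective fun x : G => x ^ p

/-- `G` is local away from the prime `p` (`p̄`-local, where `p̄` is the set of all primes other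
than `p`), i.e. uniquely `p`-divisible: every element has exactly one `p`-th root. -/
def IsLocalAwayFrom (p : ℕ) (G : Type*) [Group G] : Prop :=
  Function.Bijective fun x : G => x ^ p

/-- The `p`-localization of the integers, `{m / n ∈ ℚ | p ∤ n}`, as a subgroup of `ℚ`. -/
def integersLocalizedAt (p : Nat.Primes) : AddSubgroup ℚ where
  carrier := {x | ∃ m n : ℤ, ¬ ((p : ℕ) : ℤ) ∣ n ∧ x = m / n}
  zero_mem' := ⟨0, 1, fun h => (Nat.prime_iff_prime_int.1 p.2).not_isUnit (isUnit_of_dvd_one h),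
    by simp⟩
  add_mem' := by
    rintro _ _ ⟨m, n, hn, rfl⟩ ⟨m', n', hn', rfl⟩
    have h0 : (n : ℚ) ≠ 0 := by rintro h; exact hn (by simp [Int.cast_eq_zero.1 h])
    have h0' : (n' : ℚ) ≠ 0 := by rintro h; exact hn' (by simp [Int.cast_eq_zero.1 h])
    refine ⟨m * n' + n * m', n * n', fun h => ?_, ?_⟩
    · exact ((Nat.prime_iff_prime_int.1 p.2).dvd_or_dvd h).elim hn hn'
    · push_cast
      exact div_add_div _ _ h0 h0'
  neg_mem' := by
    rintro _ ⟨m, n, hn, rfl⟩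
    exact ⟨-m, n, hn, by push_cast; ring⟩

/-- The quasi-cyclic group `ℤ/p^∞`: the subgroup of `ℚ/ℤ` of all elements whose order is a power
of `p`. -/
def quasiCyclic (p : Nat.Primes) : AddSubgroup (ℚ ⧸ AddSubgroup.zmultiples (1 : ℚ)) where
  carrier := {x | ∃ k : ℕ, (p : ℕ) ^ k • x = 0}
  zero_mem' := ⟨0, by simp⟩
  add_mem' := by
    rintro x y ⟨k, hk⟩ ⟨l, hl⟩
    refine ⟨k + l, ?_⟩
    have hx : ((p : ℕ) ^ (k + l)) • x = 0 := by rw [pow_add, mul_comm, mul_smul, hk, smul_zero]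
    have hy : ((p : ℕ) ^ (k + l)) • y = 0 := by rw [pow_add, mul_smul, hl, smul_zero]
    rw [smul_add, hx, hy, add_zero]
  neg_mem' := by
    rintro x ⟨k, hk⟩
    exact ⟨k, by rw [smul_neg, hk, neg_zero]⟩

/-- Index set of the Bockstein groups. -/
inductive BocksteinIndex
  | rat
  | cyclic (p : Nat.Primes)
  | quasiCyclic (p : Nat.Primes)
  | localized (p : Nat.Primes)

/-- The Bockstein groups `ℚ`, `ℤ/p`, `ℤ/p^∞` and `ℤ_(p)`, `p` prime. -/
def bocksteinGroup : BocksteinIndex → AddCommGrpCat.{0}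
  | .rat => AddCommGrpCat.of ℚ
  | .cyclic p => AddCommGrpCat.of (ZMod p)
  | .quasiCyclic p => AddCommGrpCat.of (quasiCyclic p)
  | .localized p => AddCommGrpCat.of (integersLocalizedAt p)

theorem bocksteinGroup_smul_surjective_iff (q : Nat.Primes) (i : BocksteinIndex) :
    (∀ x : bocksteinGroup i, ∃ y, (q : ℕ) • y = x) ↔
      i ≠ .cyclic q ∧ i ≠ .localized q := by
  have hq0 : (q : ℚ) ≠ 0 := by exact_mod_cast q.2.ne_zero
  cases i with
  | rat =>
    simp only [ne_eq, reduceCtorEq, not_false_eq_true, and_self, iff_true]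
    change ∀ x : ℚ, ∃ y : ℚ, (q : ℕ) • y = x
    exact fun x => ⟨x / (q : ℕ), by rw [nsmul_eq_mul]; field_simp⟩
  | cyclic p =>
    have : Fact (p : ℕ).Prime := ⟨p.2⟩
    simp only [ne_eq, BocksteinIndex.cyclic.injEq, reduceCtorEq, not_false_eq_true, and_true]
    change (∀ x : ZMod p, ∃ y : ZMod p, (q : ℕ) • y = x) ↔ _
    constructor
    · rintro h rfl
      obtain ⟨y, hy⟩ := h 1
      rw [nsmul_eq_mul, CharP.cast_eq_zero, zero_mul] at hy
      exact zero_ne_one hy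
    · intro h x
      have h' : ((q : ℕ) : ZMod p) ≠ 0 := fun h0 => by
        rw [ZMod.natCast_eq_zero_iff, Nat.prime_dvd_prime_iff_eq p.2 q.2] at h0
        exact h (Subtype.ext h0)
      exact ⟨x / (q : ℕ), by rw [nsmul_eq_mul]; field_simp⟩
  | quasiCyclic p =>
    simp only [ne_eq, reduceCtorEq, not_false_eq_true, and_self, iff_true]
    rintro ⟨x, k, hk⟩
    by_cases hpq : p = q
    · subst hpq
      induction x using QuotientAddGroup.induction_on with
      | H x =>
        have hxy : (p : ℕ) • ((x / p : ℚ) : ℚ ⧸ AddSubgroup.zmultiples (1 : ℚ)) = (x : ℚ) := by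
          rw [← QuotientAddGroup.mk_nsmul, nsmul_eq_mul]; congr 1; field_simp
        have hmem : ((p : ℕ) ^ (k + 1)) •
            ((x / p : ℚ) : ℚ ⧸ AddSubgroup.zmultiples (1 : ℚ)) = 0 := by
          rw [pow_succ, mul_smul, hxy, hk]
        exact ⟨⟨_, k + 1, hmem⟩, Subtype.ext hxy⟩
    · have hc : IsCoprime ((q : ℕ) : ℤ) (((p : ℕ) ^ k : ℕ) : ℤ) :=
        Nat.isCoprime_iff_coprime.2 (Nat.Coprime.pow_right k
          ((Nat.coprime_primes q.2 p.2).2 fun h => hpq (Subtype.ext h.symm)))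
      obtain ⟨a, b, hab⟩ := hc
      refine ⟨a • (⟨x, k, hk⟩ : quasiCyclic p), Subtype.ext ?_⟩
      change (q : ℕ) • a • x = x
      have h1 : (a * ((q : ℕ) : ℤ) + b * (((p : ℕ) ^ k : ℕ) : ℤ)) • x = x := by rw [hab, one_smul]
      rw [add_smul, mul_smul, mul_smul, natCast_zsmul, natCast_zsmul, hk, smul_zero, add_zero,
        smul_comm] at h1
      exact h1
  | localized p =>
    simp only [ne_eq, BocksteinIndex.localized.injEq, reduceCtorEq, not_false_eq_true, true_and]
    have hp := Nat.prime_iff_prime_int.1 p.2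
    constructor
    · rintro h rfl
      obtain ⟨⟨_, m, n, hn, rfl⟩, hy⟩ := h (⟨1, 1, 1, fun h => hp.not_isUnit
        (isUnit_of_dvd_one h), by simp⟩ : integersLocalizedAt p)
      have hy' : (p : ℕ) • (m / n : ℚ) = 1 := congrArg Subtype.val hy
      have h0 : (n : ℚ) ≠ 0 := by rintro h; exact hn (by simp [Int.cast_eq_zero.1 h])
      rw [nsmul_eq_mul, mul_div_assoc', div_eq_one_iff_eq h0] at hy'
      exact hn ⟨m, by exact_mod_cast hy'.symm⟩
    · rintro h ⟨_, m, n, hn, rfl⟩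
      have h0 : (n : ℚ) ≠ 0 := by rintro h; exact hn (by simp [Int.cast_eq_zero.1 h])
      refine ⟨⟨m / (n * q), m, n * (q : ℕ), fun hd => ?_, by push_cast; rfl⟩, Subtype.ext ?_⟩
      · refine (hp.dvd_or_dvd hd).elim hn fun hd => h (Subtype.ext ?_)
        exact (Nat.prime_dvd_prime_iff_eq p.2 q.2).1 (Int.natCast_dvd_natCast.1 hd)
      · change (q : ℕ) • (m / (n * q) : ℚ) = m / n
        rw [nsmul_eq_mul]; field_simp

theorem bocksteinGroup_torsion_iff (q : Nat.Primes) (i : BocksteinIndex) :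
    (∃ x : bocksteinGroup i, x ≠ 0 ∧ (q : ℕ) • x = 0) ↔
      i = .cyclic q ∨ i = .quasiCyclic q := by
  have hq0 : (q : ℚ) ≠ 0 := by exact_mod_cast q.2.ne_zero
  cases i with
  | rat =>
    simp only [reduceCtorEq, or_self, iff_false]
    change ¬ ∃ x : ℚ, x ≠ 0 ∧ (q : ℕ) • x = 0
    rintro ⟨x, hx, h⟩
    exact hx ((smul_eq_zero.1 h).resolve_left q.2.ne_zero)
  | cyclic p =>
    have : Fact (p : ℕ).Prime := ⟨p.2⟩
    simp only [BocksteinIndex.cyclic.injEq, reduceCtorEq, or_false]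
    constructor
    · rintro ⟨(x : ZMod p), hx, h⟩
      change ((q : ℕ) • x : ZMod p) = 0 at h
      rw [nsmul_eq_mul, mul_eq_zero, ZMod.natCast_eq_zero_iff,
        Nat.prime_dvd_prime_iff_eq p.2 q.2] at h
      exact Subtype.ext (h.resolve_right hx)
    · rintro rfl
      refine ⟨(1 : ZMod p), one_ne_zero (α := ZMod p), ?_⟩
      change ((p : ℕ) • (1 : ZMod p)) = 0
      rw [nsmul_eq_mul, CharP.cast_eq_zero, zero_mul]
  | quasiCyclic p =>
    simp only [BocksteinIndex.quasiCyclic.injEq, reduceCtorEq, false_or]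
    constructor
    · rintro ⟨⟨x, k, hk⟩, hx, h⟩
      by_contra hpq
      have h' : (q : ℕ) • x = 0 := congrArg Subtype.val h
      have hc : IsCoprime ((q : ℕ) : ℤ) (((p : ℕ) ^ k : ℕ) : ℤ) :=
        Nat.isCoprime_iff_coprime.2 (Nat.Coprime.pow_right k
          ((Nat.coprime_primes q.2 p.2).2 fun h => hpq (Subtype.ext h.symm)))
      obtain ⟨a, b, hab⟩ := hc
      have h1 : (a * ((q : ℕ) : ℤ) + b * (((p : ℕ) ^ k : ℕ) : ℤ)) • x = x := by rw [hab, one_smul]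
      rw [add_smul, mul_smul, mul_smul, natCast_zsmul, natCast_zsmul, hk, h', smul_zero, smul_zero,
        add_zero] at h1
      exact hx (Subtype.ext h1.symm)
    · rintro rfl
      have hz : (p : ℕ) • ((1 / p : ℚ) : ℚ ⧸ AddSubgroup.zmultiples (1 : ℚ)) = 0 := by
        rw [← QuotientAddGroup.mk_nsmul, QuotientAddGroup.eq_zero_iff, nsmul_eq_mul,
          mul_one_div_cancel hq0]
        exact AddSubgroup.mem_zmultiples 1
      refine ⟨(⟨_, 1, (pow_one (p : ℕ)).symm ▸ hz⟩ : quasiCyclic p), fun h => ?_, Subtype.ext hz⟩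
      have h' : ((1 / p : ℚ) : ℚ ⧸ AddSubgroup.zmultiples (1 : ℚ)) = 0 := congrArg Subtype.val h
      rw [QuotientAddGroup.eq_zero_iff, AddSubgroup.mem_zmultiples_iff] at h'
      obtain ⟨n, hn⟩ := h'
      rw [zsmul_eq_mul, mul_one, eq_div_iff hq0] at hn
      have hn' : n * ((p : ℕ) : ℤ) = 1 := by exact_mod_cast hn
      exact (Nat.prime_iff_prime_int.1 p.2).not_isUnit
        (isUnit_of_dvd_one ⟨n, by rw [mul_comm, hn']⟩)
  | localized p =>
    simp only [reduceCtorEq, or_self, iff_false]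
    rintro ⟨⟨x, hx'⟩, hx, h⟩
    have h' : (q : ℕ) • x = 0 := congrArg Subtype.val h
    exact hx (Subtype.ext ((smul_eq_zero.1 h').resolve_left q.2.ne_zero))

/-- The Bockstein groups are pairwise non-isomorphic. -/
theorem bocksteinGroup_injective {i j : BocksteinIndex}
    (e : bocksteinGroup i ≃+ bocksteinGroup j) : i = j := by
  have hA (q : Nat.Primes) : (i ≠ .cyclic q ∧ i ≠ .localized q) ↔
      (j ≠ .cyclic q ∧ j ≠ .localized q) := by
    rw [← bocksteinGroup_smul_surjective_iff, ← bocksteinGroup_smul_surjective_iff]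
    refine ⟨fun h x => ?_, fun h x => ?_⟩
    · obtain ⟨y, hy⟩ := h (e.symm x)
      exact ⟨e y, by rw [← map_nsmul, hy, e.apply_symm_apply]⟩
    · obtain ⟨y, hy⟩ := h (e x)
      exact ⟨e.symm y, by rw [← map_nsmul, hy, e.symm_apply_apply]⟩
  have hT (q : Nat.Primes) : (i = .cyclic q ∨ i = .quasiCyclic q) ↔
      (j = .cyclic q ∨ j = .quasiCyclic q) := by
    rw [← bocksteinGroup_torsion_iff, ← bocksteinGroup_torsion_iff]
    refine ⟨fun ⟨x, hx, h⟩ => ⟨e x, ?_, ?_⟩, fun ⟨x, hx, h⟩ => ⟨e.symm x, ?_, ?_⟩⟩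
    · simpa using hx
    · rw [← map_nsmul, h, map_zero]
    · simpa using hx
    · rw [← map_nsmul, h, map_zero]
  cases i with
  | rat =>
    cases j with
    | rat => rfl
    | cyclic q | quasiCyclic q => simpa using hT q
    | localized q => simpa using hA q
  | cyclic p =>
    cases j with
    | rat | localized => simpa using hT p
    | cyclic => simpa [eq_comm] using hT p
    | quasiCyclic => simpa using hA p
  | quasiCyclic p =>
    cases j with
    | rat | localized => simpa using hT p
    | quasiCyclic => simpa [eq_comm] using hT p
    | cyclic q => simpa using hA q
  | localized p =>
    cases j with
    | rat | quasiCyclic => simpa using hA p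
    | localized => simpa [eq_comm] using hA p
    | cyclic q => simpa using hT q

/-- The condition on `G` that puts a given Bockstein group into the Bockstein basis of `G`. -/
def BocksteinCondition (G : Type*) [Group G] : BocksteinIndex → Prop
  | .rat => torSubgroup G ≠ ⊤
  | .cyclic p => ¬ IsDivisibleBy p G
  | .quasiCyclic p => ¬ IsLocalAwayFrom p G
  | .localized p => ¬ IsLocalAwayFrom p (torFreeQuotient G)

/-- The Bockstein basis `σ(G)` of a nilpotent group `G`, a class of Bockstein groups.  Groups are
taken up to isomorphism, so the set is closed under isomorphism. -/
def bocksteinBasis (G : Type*) [Group G] : Set AddCommGrpCat.{0} :=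
  {H | ∃ i, Nonempty (H ≃+ bocksteinGroup i) ∧ BocksteinCondition G i}

/-- A Bockstein group lies in `σ(G)` if and only if its defining condition holds. -/
theorem bocksteinGroup_mem_bocksteinBasis_iff (G : Type*) [Group G] (i : BocksteinIndex) :
    bocksteinGroup i ∈ bocksteinBasis G ↔ BocksteinCondition G i := by
  refine ⟨?_, fun h => ⟨i, ⟨AddEquiv.refl _⟩, h⟩⟩
  rintro ⟨j, ⟨e⟩, h⟩
  rwa [bocksteinGroup_injective e]

/-- The torsion-divisible part `σ_TD(G)`: all `ℤ/p^∞` belonging to `σ(G)`. -/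
def bocksteinBasisTD (G : Type*) [Group G] : Set AddCommGrpCat.{0} :=
  {H | H ∈ bocksteinBasis G ∧ ∃ p : Nat.Primes, Nonempty (H ≃+ quasiCyclic p)}

/-- `σ_NTD(G) = σ(G) \ σ_TD(G)`. -/
def bocksteinBasisNTD (G : Type*) [Group G] : Set AddCommGrpCat.{0} :=
  bocksteinBasis G \ bocksteinBasisTD G

/-! Everything is an induction on nilpotency class. If `lcs G (n + 2) = ⊥`, then for `b` in `lcs G
n` the map `a ↦ ⁅b, a⁆` is a homomorphism to the center that kills `lcs G 1`. So the last term,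
generated by such commutators, inherits divisibility or torsion from the abelianization; modulo it
the class drops, and central corrections lift the result.

This gives the conditions for `ℤ/p` (`exists_pow_eq_of_mem_lcs`) and `ℚ`
(`isOfFinOrder_of_lcs_eq_bot`). For `ℤ_(p)`, roots in the torsion-free group `F(G)` are unique, so
only divisibility modulo torsion is at stake (`exists_pow_mul_isOfFinOrder`).

For `ℤ/p^∞` only one direction is proved: roots inside the commutator subgroup make `Ab(G)` local
when `G` is. The converse fails for the rational Heisenberg group modulo a central copy of `ℤ`. -/

open scoped commutatorElement IsMulCommutative

/-! ### Lower central series and commutators into the last term. -/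

section LowerCentralSeries

variable {G H : Type*} [Group G] [Group H]

/-- The `n`-th term of the lower central series of `G`, starting with `G` itself. -/
abbrev lcs (G : Type*) [Group G] (n : ℕ) : Subgroup G := (⊤ : Subgroup G).lowerCentralSeries n

theorem map_lcs_of_surjective {f : G →* H} (hf : Function.Surjective f) (n : ℕ) :
    (lcs G n).map f = lcs H n := by
  rw [lcs, lcs, ← Subgroup.map_top_of_surjective f hf, Subgroup.map_lowerCentralSeries]

theorem map_mem_lcs {f : G →* H} (hf : Function.Surjective f) {n : ℕ} {g : G} (hg : g ∈ lcs G n) :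
    f g ∈ lcs H n :=
  map_lcs_of_surjective hf n ▸ Subgroup.mem_map_of_mem f hg

theorem lcs_eq_bot_of_surjective {f : G →* H} (hf : Function.Surjective f) {n : ℕ}
    (h : lcs G n = ⊥) : lcs H n = ⊥ := by
  rw [← map_lcs_of_surjective hf, h, Subgroup.map_bot]

theorem lcs_quotient_eq_bot (n : ℕ) : lcs (G ⧸ lcs G n) n = ⊥ := by
  rw [← map_lcs_of_surjective (QuotientGroup.mk'_surjective (lcs G n)), eq_bot_iff,
    Subgroup.map_le_iff_le_comap]
  intro x hx
  rw [Subgroup.mem_comap, Subgroup.mem_bot]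
  exact (QuotientGroup.eq_one_iff x).2 hx

/-- The shift makes the abelian case the base `n = 0` of the inductions. -/
theorem Group.IsNilpotent.exists_lcs_succ_eq_bot (G : Type*) [Group G] [Group.IsNilpotent G] :
    ∃ n, lcs G (n + 1) = ⊥ := by
  obtain ⟨n, hn⟩ := Subgroup.nilpotent_iff_lowerCentralSeries.1 ‹Group.IsNilpotent G›
  exact ⟨n, eq_bot_iff.2 ((Subgroup.lowerCentralSeries_antitone ⊤ n.le_succ).trans hn.le)⟩

theorem eq_one_of_mem_lcs {n i : ℕ} (h : lcs G n = ⊥) (hi : n ≤ i) {g : G} (hg : g ∈ lcs G i) :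
    g = 1 :=
  Subgroup.mem_bot.1 (h ▸ Subgroup.lowerCentralSeries_antitone ⊤ hi hg)

theorem lcs_le_center {n : ℕ} (h : lcs G (n + 1) = ⊥) : lcs G n ≤ Subgroup.center G := by
  intro z hz
  rw [Subgroup.mem_center_iff]
  intro g
  have : ⁅z, g⁆ ∈ lcs G (n + 1) := Subgroup.commutator_mem_commutator hz (Subgroup.mem_top _)
  rw [h, Subgroup.mem_bot] at this
  exact (commutatorElement_eq_one_iff_mul_comm.1 this).symm

/-- If `b` lies in the last but one non-(Subgroup.mem_top _) term of the lower central series, then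
`a ↦ ⁅b, a⁆` is a homomorphism to the center. -/
def commutatorHom {n : ℕ} (h : lcs G (n + 2) = ⊥) (b : G) (hb : b ∈ lcs G n) :
    G →* Subgroup.center G :=
  MonoidHom.mk' (fun a => ⟨⁅b, a⁆, lcs_le_center h
    (Subgroup.commutator_mem_commutator hb (Subgroup.mem_top _))⟩) fun a a' => Subtype.ext (by
      have hc : ⁅b, a'⁆ ∈ Subgroup.center G :=
        lcs_le_center h (Subgroup.commutator_mem_commutator hb (Subgroup.mem_top _))
      have := Subgroup.mem_center_iff.1 hc a
      calc ⁅b, a * a'⁆ = ⁅b, a⁆ * (a * ⁅b, a'⁆) * a⁻¹ := by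
            simp only [commutatorElement_def]; group
        _ = ⁅b, a⁆ * ⁅b, a'⁆ := by rw [this]; group)

@[simp]
theorem coe_commutatorHom {n : ℕ} (h : lcs G (n + 2) = ⊥) (b : G) (hb : b ∈ lcs G n) (a : G) :
    (commutatorHom h b hb a : G) = ⁅b, a⁆ := rfl

/-- The target is commutative, so commutators die. -/
theorem commutatorHom_eq_one {n : ℕ} (h : lcs G (n + 2) = ⊥) (b : G) (hb : b ∈ lcs G n) {a : G}
    (ha : a ∈ lcs G 1) : commutatorHom h b hb a = 1 :=
  Abelianization.commutator_subset_ker (commutatorHom h b hb) ha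

/-- The `p`-th powers of the elements of a central subgroup. -/
def Subgroup.centralPowers (K : Subgroup G) (hK : K ≤ Subgroup.center G) (p : ℕ) :
    Subgroup G where
  carrier := {z | ∃ w ∈ K, w ^ p = z}
  one_mem' := ⟨1, K.one_mem, one_pow p⟩
  mul_mem' := by
    rintro _ _ ⟨w, hw, rfl⟩ ⟨w', hw', rfl⟩
    exact ⟨w * w', K.mul_mem hw hw',
      Commute.mul_pow (Subgroup.mem_center_iff.1 (hK hw') w) p⟩
  inv_mem' := by
    rintro _ ⟨w, hw, rfl⟩
    exact ⟨w⁻¹, K.inv_mem hw, inv_pow w p⟩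

theorem mul_pow_of_mem_center {z : G} (hz : z ∈ Subgroup.center G) (x : G) (p : ℕ) :
    (x * z) ^ p = x ^ p * z ^ p :=
  Commute.mul_pow (Subgroup.mem_center_iff.1 hz x) p

end LowerCentralSeries

/-! ### Divisibility and the abelianization. -/

section Divisible

/-- If the abelianization of a nilpotent group is divisible by `p`, then so is every term of the
lower central series. -/
theorem exists_pow_eq_of_mem_lcs (p n : ℕ) : ∀ (G : Type*) [Group G], lcs G (n + 1) = ⊥ →
    (∀ g : G, ∃ x, ∃ c ∈ lcs G 1, g = x ^ p * c) →
    ∀ i, ∀ g ∈ lcs G i, ∃ x ∈ lcs G i, x ^ p = g := by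
  induction n with
  | zero =>
    intro G _ h hdiv i g hg
    obtain _ | i := i
    · obtain ⟨x, c, hc, rfl⟩ := hdiv g
      rw [h, Subgroup.mem_bot] at hc
      exact ⟨x, Subgroup.mem_top _, by rw [hc, mul_one]⟩
    · exact ⟨1, Subgroup.one_mem _,
        by rw [eq_one_of_mem_lcs h (Nat.le_add_left 1 i) hg, one_pow]⟩
  | succ n ih =>
    intro G _ h hdiv i g hg
    -- The central correction `w` below lies in `lcs G (n + 1)`, hence in `lcs G i` only for `i ≤ n
    -- + 1`; later terms are trivial.
    rcases le_or_gt i (n + 1) with hi | hi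
    · have hZ := lcs_le_center h
      have hmk := QuotientGroup.mk'_surjective (lcs G (n + 1))
      -- Since `p`-th powers of a central subgroup form a subgroup, generators suffice: `⁅b, x ^ p *
      -- c⁆ = ⁅b, x⁆ ^ p`.
      have hlast : lcs G (n + 1) ≤ (lcs G (n + 1)).centralPowers hZ p := by
        refine Subgroup.commutator_le.2 fun b hb a _ => ?_
        obtain ⟨x, c, hc, rfl⟩ := hdiv a
        refine ⟨⁅b, x⁆, Subgroup.commutator_mem_commutator hb (Subgroup.mem_top _), ?_⟩
        have := congrArg Subtype.val (map_mul (commutatorHom h b hb) (x ^ p) c)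
        rw [commutatorHom_eq_one h b hb hc, mul_one, map_pow] at this
        exact this.symm
      have hdiv' : ∀ g : G ⧸ lcs G (n + 1), ∃ x, ∃ c ∈ lcs (G ⧸ lcs G (n + 1)) 1,
          g = x ^ p * c := by
        intro g
        obtain ⟨g, rfl⟩ := hmk g
        obtain ⟨x, c, hc, rfl⟩ := hdiv g
        exact ⟨_, _, map_mem_lcs hmk hc, by rw [map_mul, map_pow]⟩
      obtain ⟨y, hy, hyg⟩ := ih _ (lcs_quotient_eq_bot (n + 1)) hdiv' i _ (map_mem_lcs hmk hg)
      rw [← map_lcs_of_surjective hmk] at hy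
      obtain ⟨x, hx, rfl⟩ := hy
      obtain ⟨w, hw, hwp⟩ := hlast (QuotientGroup.eq.1 hyg)
      refine ⟨x * w, mul_mem hx (Subgroup.lowerCentralSeries_antitone ⊤ hi hw), ?_⟩
      rw [mul_pow_of_mem_center (hZ hw), hwp, mul_inv_cancel_left]
    · exact ⟨1, Subgroup.one_mem _,
        by rw [eq_one_of_mem_lcs h (Nat.succ_le_of_lt hi) hg, one_pow]⟩

variable {G H : Type*} [Group G] [Group H] {p : ℕ}

theorem IsDivisibleBy.of_surjective {f : G →* H} (hf : Function.Surjective f)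
    (h : IsDivisibleBy p G) : IsDivisibleBy p H := by
  intro y
  obtain ⟨g, rfl⟩ := hf y
  obtain ⟨x, rfl⟩ := h g
  exact ⟨f x, (map_pow f x p).symm⟩

theorem Abelianization.of_surjective : Function.Surjective (Abelianization.of (G := G)) :=
  QuotientGroup.mk'_surjective _

theorem Abelianization.of_eq_of_iff {a b : G} :
    Abelianization.of a = Abelianization.of b ↔ a⁻¹ * b ∈ lcs G 1 :=
  QuotientGroup.eq

theorem Abelianization.of_eq_one_iff {a : G} : Abelianization.of a = 1 ↔ a ∈ lcs G 1 :=
  QuotientGroup.eq_one_iff a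

theorem IsDivisibleBy.exists_pow_eq_of_mem_lcs [Group.IsNilpotent G]
    (h : IsDivisibleBy p (Abelianization G)) (i : ℕ) {g : G} (hg : g ∈ lcs G i) :
    ∃ x ∈ lcs G i, x ^ p = g := by
  obtain ⟨n, hn⟩ := Group.IsNilpotent.exists_lcs_succ_eq_bot G
  refine _root_.exists_pow_eq_of_mem_lcs p n G hn (fun g => ?_) i g hg
  obtain ⟨y, hy⟩ := h (Abelianization.of g)
  obtain ⟨x, rfl⟩ := Abelianization.of_surjective y
  refine ⟨x, _, Abelianization.of_eq_of_iff.1 ((map_pow _ x p).trans hy), ?_⟩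
  rw [mul_inv_cancel_left]

theorem isDivisibleBy_abelianization_iff [Group.IsNilpotent G] :
    IsDivisibleBy p (Abelianization G) ↔ IsDivisibleBy p G := by
  refine ⟨fun h g => ?_, IsDivisibleBy.of_surjective Abelianization.of_surjective⟩
  obtain ⟨x, -, hx⟩ := h.exists_pow_eq_of_mem_lcs 0 (Subgroup.mem_top g)
  exact ⟨x, hx⟩

/-- If `g ^ p` is in the commutator subgroup, it has a root there, which is `g` by uniqueness of
roots in `G`. -/
theorem IsLocalAwayFrom.abelianization [Group.IsNilpotent G] (h : IsLocalAwayFrom p G) :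
    IsLocalAwayFrom p (Abelianization G) := by
  have hdiv : IsDivisibleBy p (Abelianization G) := isDivisibleBy_abelianization_iff.2 h.2
  refine ⟨(injective_iff_map_eq_one (powMonoidHom p : Abelianization G →* _)).2 fun a ha => ?_,
    hdiv⟩
  obtain ⟨g, rfl⟩ := Abelianization.of_surjective a
  rw [powMonoidHom_apply, ← map_pow, Abelianization.of_eq_one_iff] at ha
  obtain ⟨x, hx, hxg⟩ := hdiv.exists_pow_eq_of_mem_lcs 1 ha
  rw [Abelianization.of_eq_one_iff, ← h.1 hxg]
  exact hx

end Divisible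

/-! ### Torsion in nilpotent groups. -/

section Torsion

/-- A nilpotent group whose abelianization is torsion is torsion. -/
theorem isOfFinOrder_of_lcs_eq_bot (n : ℕ) : ∀ (G : Type*) [Group G], lcs G (n + 1) = ⊥ →
    (∀ g : G, ∃ m, 0 < m ∧ g ^ m ∈ lcs G 1) → ∀ g : G, IsOfFinOrder g := by
  induction n with
  | zero =>
    intro G _ h htor g
    obtain ⟨m, hm, hg⟩ := htor g
    rw [h, Subgroup.mem_bot] at hg
    exact isOfFinOrder_iff_pow_eq_one.2 ⟨m, hm, hg⟩
  | succ n ih =>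
    intro G _ h htor g
    have hmk := QuotientGroup.mk'_surjective (lcs G (n + 1))
    have hlast : lcs G (n + 1) ≤
        (CommGroup.torsion (Subgroup.center G)).map (Subgroup.center G).subtype := by
      refine Subgroup.commutator_le.2 fun b hb a _ => ⟨commutatorHom h b hb a, ?_, rfl⟩
      obtain ⟨m, hm, ha⟩ := htor a
      refine isOfFinOrder_iff_pow_eq_one.2 ⟨m, hm, ?_⟩
      rw [← map_pow, commutatorHom_eq_one h b hb ha]
    have htor' : ∀ g : G ⧸ lcs G (n + 1), ∃ m, 0 < m ∧ g ^ m ∈ lcs (G ⧸ lcs G (n + 1)) 1 := by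
      intro g
      obtain ⟨g, rfl⟩ := hmk g
      obtain ⟨m, hm, hg⟩ := htor g
      exact ⟨m, hm, map_pow (QuotientGroup.mk' (lcs G (n + 1))) g m ▸ map_mem_lcs hmk hg⟩
    obtain ⟨m, hm, hg⟩ := isOfFinOrder_iff_pow_eq_one.1
      (ih _ (lcs_quotient_eq_bot (n + 1)) htor' (QuotientGroup.mk' _ g))
    rw [← map_pow] at hg
    obtain ⟨z, hz, hzg⟩ := hlast ((QuotientGroup.eq_one_iff (g ^ m)).1 hg)
    have : IsOfFinOrder (g ^ m) := hzg ▸ (Subgroup.center G).subtype.isOfFinOrder hz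
    exact (isOfFinOrder_pow.1 this).resolve_right hm.ne'

variable {G H : Type*} [Group G] [Group H]

theorem isOfFinOrder_of_abelianization [Group.IsNilpotent G]
    (h : ∀ a : Abelianization G, IsOfFinOrder a) (g : G) : IsOfFinOrder g := by
  obtain ⟨n, hn⟩ := Group.IsNilpotent.exists_lcs_succ_eq_bot G
  refine isOfFinOrder_of_lcs_eq_bot n G hn (fun g => ?_) g
  obtain ⟨m, hm, hg⟩ := isOfFinOrder_iff_pow_eq_one.1 (h (Abelianization.of g))
  exact ⟨m, hm, Abelianization.of_eq_one_iff.1 ((map_pow _ g m).trans hg)⟩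

theorem isOfFinOrder_of_mem_torSubgroup_of_comm {A : Type*} [CommGroup A] {a : A}
    (ha : a ∈ torSubgroup A) : IsOfFinOrder a :=
  (Subgroup.closure_le (CommGroup.torsion A)).2 (fun _ h => h) ha

theorem map_mem_torSubgroup (f : G →* H) {g : G} (hg : g ∈ torSubgroup G) :
    f g ∈ torSubgroup H := by
  have : torSubgroup G ≤ (torSubgroup H).comap f :=
    (Subgroup.closure_le _).2 fun x hx => Subgroup.subset_closure (f.isOfFinOrder hx)
  exact this hg

theorem isOfFinOrder_of_torSubgroup_eq_top [Group.IsNilpotent G] (h : torSubgroup G = ⊤) (g : G) :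
    IsOfFinOrder g := by
  refine isOfFinOrder_of_abelianization (fun a => ?_) g
  obtain ⟨x, rfl⟩ := Abelianization.of_surjective a
  exact isOfFinOrder_of_mem_torSubgroup_of_comm (map_mem_torSubgroup _ (h ▸ Subgroup.mem_top x))

/-- In a nilpotent group the elements of finite order form a subgroup. -/
theorem mem_torSubgroup_iff [Group.IsNilpotent G] {g : G} :
    g ∈ torSubgroup G ↔ IsOfFinOrder g := by
  refine ⟨fun hg => ?_, fun hg => Subgroup.subset_closure hg⟩
  -- `Tor(G)` is itself nilpotent and generated by its own torsion elements.
  have htop : torSubgroup (torSubgroup G) = ⊤ := by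
    refine top_unique (Subgroup.map_subtype_le_map_subtype.1 ?_)
    rw [← MonoidHom.range_eq_map, Subgroup.range_subtype]
    refine (Subgroup.closure_le _).2 fun x hx => ?_
    exact ⟨⟨x, Subgroup.subset_closure hx⟩, Subgroup.subset_closure
      (Submonoid.isOfFinOrder_coe.1 hx), rfl⟩
  exact (torSubgroup G).subtype.isOfFinOrder
    (isOfFinOrder_of_torSubgroup_eq_top htop ⟨g, hg⟩)

theorem torSubgroup_abelianization_eq_top_iff [Group.IsNilpotent G] :
    torSubgroup (Abelianization G) = ⊤ ↔ torSubgroup G = ⊤ := by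
  simp only [Subgroup.eq_top_iff', mem_torSubgroup_iff]
  refine ⟨fun h g => isOfFinOrder_of_abelianization h g, fun h a => ?_⟩
  obtain ⟨x, rfl⟩ := Abelianization.of_surjective a
  exact MonoidHom.isOfFinOrder _ (h x)

theorem torFreeQuotient_eq_one_of_isOfFinOrder [Group.IsNilpotent G] {a : torFreeQuotient G}
    (ha : IsOfFinOrder a) : a = 1 := by
  obtain ⟨g, rfl⟩ := QuotientGroup.mk'_surjective _ a
  obtain ⟨m, hm, hg⟩ := isOfFinOrder_iff_pow_eq_one.1 ha
  rw [← map_pow] at hg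
  have := mem_torSubgroup_iff.1 ((QuotientGroup.eq_one_iff _).1 hg)
  exact (QuotientGroup.eq_one_iff g).2
    (mem_torSubgroup_iff.2 ((isOfFinOrder_pow.1 this).resolve_right hm.ne'))

end Torsion

/-! ### Unique roots and divisibility modulo torsion. -/

section TorsionFree

variable {G : Type*} [Group G]

/-- Roots in a torsion-free nilpotent group are unique. -/
theorem eq_of_pow_eq_pow_of_torsionFree [Group.IsNilpotent G]
    (htf : ∀ g : G, IsOfFinOrder g → g = 1) {m : ℕ} (hm : 0 < m) {x y : G} (h : x ^ m = y ^ m) :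
    x = y := by
  -- Conjugating `x` by `y` keeps its `m`-th power and changes `x` only by an element one level
  -- lower in the upper central series. By induction `x` and `y` commute, so `y⁻¹ * x` is torsion.
  have key : ∀ i, ∀ x y : G, y⁻¹ * x ∈ Subgroup.upperCentralSeries G i → x ^ m = y ^ m →
      x = y := by
    intro i
    induction i with
    | zero =>
      intro x y hx _
      exact (inv_mul_eq_one.1 (Subgroup.mem_bot.1 hx)).symm
    | succ i ih =>
      intro x y hx hxy
      have hconj : y⁻¹ * x * y = x := by
        refine ih _ _ ?_ ?_
        · have := Subgroup.mem_upperCentralSeries_succ_iff.1 (inv_mem hx) y⁻¹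
          convert this using 1
          rw [commutatorElement_def]
          group
        · have := conj_pow (a := y⁻¹) (b := x) (i := m)
          rw [inv_inv] at this
          rw [this, hxy, (Commute.self_pow y m).inv_left.eq, inv_mul_cancel_right]
      have hcomm : Commute y x := by
        have := congrArg (y * ·) hconj
        simp only [mul_assoc, mul_inv_cancel_left] at this
        exact this.symm
      have : IsOfFinOrder (y⁻¹ * x) := by
        refine isOfFinOrder_iff_pow_eq_one.2 ⟨m, hm, ?_⟩
        rw [hcomm.inv_left.mul_pow, inv_pow, hxy, inv_mul_cancel]
      exact (inv_mul_eq_one.1 (htf _ this)).symm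
  obtain ⟨n, hn⟩ := Group.IsNilpotent.nilpotent G
  exact key n x y (hn ▸ Subgroup.mem_top _) h

/-- `z` and its conjugates have the same `m`-th power. -/
theorem mem_center_of_pow_mem_center [Group.IsNilpotent G]
    (htf : ∀ g : G, IsOfFinOrder g → g = 1) {m : ℕ} (hm : 0 < m) {z : G}
    (hz : z ^ m ∈ Subgroup.center G) : z ∈ Subgroup.center G := by
  refine Subgroup.mem_center_iff.2 fun g => ?_
  rw [← mul_inv_eq_iff_eq_mul]
  refine eq_of_pow_eq_pow_of_torsionFree htf hm ?_
  rw [conj_pow, mul_inv_eq_iff_eq_mul]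
  exact Subgroup.mem_center_iff.1 hz g

/-- In a torsion-free nilpotent group a central subgroup divisible by a prime `p` has an isolator
divisible by `p`. -/
theorem exists_pow_eq_of_pow_mem [Group.IsNilpotent G]
    (htf : ∀ g : G, IsOfFinOrder g → g = 1) {p : ℕ} (hp : p.Prime) {K : Subgroup G}
    (hK : K ≤ Subgroup.center G) (hdiv : ∀ z ∈ K, ∃ w ∈ K, w ^ p = z) {m : ℕ} (hm : 0 < m) {z : G}
    (hz : z ^ m ∈ K) : ∃ u ∈ Subgroup.center G, u ^ p = z := by
  induction m using Nat.strong_induction_on with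
  | _ m ih =>
    obtain ⟨w, hw, hwz⟩ := hdiv _ hz
    -- If `m = p * l`, uniqueness of roots gives `z ^ l = w ∈ K`. If `p ∤ m`, Bézout `a * m + b * p
    -- = 1` gives the root `w ^ a * z ^ b`.
    by_cases hpm : p ∣ m
    · obtain ⟨l, rfl⟩ := hpm
      have hl : 0 < l := Nat.pos_of_mul_pos_left hm
      refine ih l (lt_mul_of_one_lt_left hl hp.one_lt) hl ?_
      rw [mul_comm, pow_mul] at hwz
      rwa [← eq_of_pow_eq_pow_of_torsionFree htf hp.pos hwz]
    · have hzc := mem_center_of_pow_mem_center htf hm (hK hz)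
      have hcop : IsCoprime (m : ℤ) (p : ℤ) :=
        Nat.isCoprime_iff_coprime.2 ((Nat.Prime.coprime_iff_not_dvd hp).2 hpm).symm
      obtain ⟨a, b, hab⟩ := hcop
      refine ⟨w ^ a * z ^ b, mul_mem (zpow_mem (hK hw) a) (zpow_mem hzc b), ?_⟩
      rw [mul_pow_of_mem_center (zpow_mem hzc b), ← zpow_natCast, ← zpow_natCast, ← zpow_mul,
        ← zpow_mul, mul_comm a, zpow_mul, zpow_natCast, hwz, ← zpow_natCast, ← zpow_mul, ← zpow_add,
        mul_comm, hab, zpow_one]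

/-- If the abelianization of a nilpotent group is divisible by `p` modulo torsion, then so is the
group. -/
theorem exists_pow_mul_isOfFinOrder {p : ℕ} (hp : p.Prime) (n : ℕ) :
    ∀ (G : Type*) [Group G], lcs G (n + 1) = ⊥ →
      (∀ g : G, ∃ x t : G, ∃ m, 0 < m ∧ t ^ m ∈ lcs G 1 ∧ g = x ^ p * t) →
      ∀ g : G, ∃ x t : G, IsOfFinOrder t ∧ g = x ^ p * t := by
  induction n with
  | zero =>
    intro G _ h hdiv g
    obtain ⟨x, t, m, hm, ht, rfl⟩ := hdiv g
    rw [h, Subgroup.mem_bot] at ht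
    exact ⟨x, t, isOfFinOrder_iff_pow_eq_one.2 ⟨m, hm, ht⟩, rfl⟩
  | succ n ih =>
    have hquot {G H : Type _} [Group G] [Group H] {f : G →* H} (hf : Function.Surjective f)
        (hdiv : ∀ g : G, ∃ x t : G, ∃ m, 0 < m ∧ t ^ m ∈ lcs G 1 ∧ g = x ^ p * t) (g : H) :
        ∃ x t : H, ∃ m, 0 < m ∧ t ^ m ∈ lcs H 1 ∧ g = x ^ p * t := by
      obtain ⟨g, rfl⟩ := hf g
      obtain ⟨x, t, m, hm, ht, rfl⟩ := hdiv g
      exact ⟨f x, f t, m, hm, map_pow f t m ▸ map_mem_lcs hf ht, by rw [map_mul, map_pow]⟩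
    -- Torsion-free case. The quotient by the last term may have torsion, so induction gives a root
    -- only up to an element with a power in that term; `exists_pow_eq_of_pow_mem` supplies its
    -- central root.
    have htf {G : Type _} [Group G] (h : lcs G (n + 2) = ⊥)
        (htf : ∀ g : G, IsOfFinOrder g → g = 1)
        (hdiv : ∀ g : G, ∃ x t : G, ∃ m, 0 < m ∧ t ^ m ∈ lcs G 1 ∧ g = x ^ p * t) (g : G) :
        ∃ x, x ^ p = g := by
      have : Group.IsNilpotent G := Subgroup.nilpotent_iff_lowerCentralSeries.2 ⟨_, h⟩
      have hZ := lcs_le_center h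
      have hmk := QuotientGroup.mk'_surjective (lcs G (n + 1))
      have hlast : lcs G (n + 1) ≤ (lcs G (n + 1)).centralPowers hZ p := by
        refine Subgroup.commutator_le.2 fun b hb a _ => ?_
        obtain ⟨x, t, m, hm, ht, rfl⟩ := hdiv a
        refine ⟨⁅b, x⁆, Subgroup.commutator_mem_commutator hb (Subgroup.mem_top _), ?_⟩
        have h1 : ⁅b, t⁆ = 1 := by
          refine htf _ (isOfFinOrder_iff_pow_eq_one.2 ⟨m, hm, ?_⟩)
          have := congrArg Subtype.val (commutatorHom_eq_one h b hb ht)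
          rwa [map_pow] at this
        have := congrArg Subtype.val (map_mul (commutatorHom h b hb) (x ^ p) t)
        rw [map_pow, Subgroup.coe_mul, Subgroup.coe_pow] at this
        simp only [coe_commutatorHom, h1, mul_one] at this
        exact this.symm
      obtain ⟨x, t, ht, hg⟩ := ih _ (lcs_quotient_eq_bot (n + 1)) (hquot hmk hdiv)
        (QuotientGroup.mk' _ g)
      obtain ⟨x, rfl⟩ := hmk x
      obtain ⟨m, hm, ht⟩ := isOfFinOrder_iff_pow_eq_one.1 ht
      rw [← inv_mul_eq_iff_eq_mul, ← map_pow, ← map_inv, ← map_mul] at hg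
      rw [← hg, ← map_pow] at ht
      obtain ⟨u, hu, hup⟩ := exists_pow_eq_of_pow_mem htf hp hZ hlast hm
        ((QuotientGroup.eq_one_iff _).1 ht)
      exact ⟨x * u, by rw [mul_pow_of_mem_center hu, hup, mul_inv_cancel_left]⟩
    intro G _ h hdiv g
    have : Group.IsNilpotent G := Subgroup.nilpotent_iff_lowerCentralSeries.2 ⟨_, h⟩
    -- The general case follows by applying `htf` to `F(G)`.
    have hmk := QuotientGroup.mk'_surjective (torSubgroup G)
    obtain ⟨x, hx⟩ := htf (lcs_eq_bot_of_surjective hmk h)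
      (fun _ => torFreeQuotient_eq_one_of_isOfFinOrder) (hquot hmk hdiv) (QuotientGroup.mk' _ g)
    obtain ⟨x, rfl⟩ := hmk x
    exact ⟨x, _, mem_torSubgroup_iff.1 (QuotientGroup.eq.1 hx), (mul_inv_cancel_left _ _).symm⟩

/-- Injectivity is automatic, as `F(G)` is torsion-free nilpotent. -/
theorem isLocalAwayFrom_torFreeQuotient_iff [Group.IsNilpotent G] {p : ℕ} (hp : p.Prime) :
    IsLocalAwayFrom p (torFreeQuotient G) ↔
      ∀ g : G, ∃ x t : G, IsOfFinOrder t ∧ g = x ^ p * t := by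
  have hmk := QuotientGroup.mk'_surjective (torSubgroup G)
  refine ⟨fun h g => ?_, fun h => ⟨fun x y hxy => ?_, fun a => ?_⟩⟩
  · obtain ⟨x, hx⟩ := h.2 (QuotientGroup.mk' _ g)
    obtain ⟨x, rfl⟩ := hmk x
    exact ⟨x, _, mem_torSubgroup_iff.1 (QuotientGroup.eq.1 hx), (mul_inv_cancel_left _ _).symm⟩
  · exact eq_of_pow_eq_pow_of_torsionFree (fun _ => torFreeQuotient_eq_one_of_isOfFinOrder)
      hp.pos hxy
  · obtain ⟨g, rfl⟩ := hmk a
    obtain ⟨x, t, ht, rfl⟩ := h g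
    refine ⟨QuotientGroup.mk' _ x, ?_⟩
    have ht' : QuotientGroup.mk' (torSubgroup G) t = 1 :=
      (QuotientGroup.eq_one_iff t).2 (mem_torSubgroup_iff.2 ht)
    rw [map_mul, ht', mul_one, map_pow]

theorem isLocalAwayFrom_torFreeQuotient_abelianization_iff [Group.IsNilpotent G] {p : ℕ}
    (hp : p.Prime) :
    IsLocalAwayFrom p (torFreeQuotient (Abelianization G)) ↔
      IsLocalAwayFrom p (torFreeQuotient G) := by
  rw [isLocalAwayFrom_torFreeQuotient_iff hp, isLocalAwayFrom_torFreeQuotient_iff hp]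
  refine ⟨fun h => ?_, fun h a => ?_⟩
  · obtain ⟨n, hn⟩ := Group.IsNilpotent.exists_lcs_succ_eq_bot G
    refine exists_pow_mul_isOfFinOrder hp n G hn fun g => ?_
    obtain ⟨x, t, ht, hg⟩ := h (Abelianization.of g)
    obtain ⟨x, rfl⟩ := Abelianization.of_surjective x
    obtain ⟨m, hm, ht⟩ := isOfFinOrder_iff_pow_eq_one.1 ht
    rw [← inv_mul_eq_iff_eq_mul, ← map_pow, ← map_inv, ← map_mul] at hg
    rw [← hg, ← map_pow] at ht
    exact ⟨x, _, m, hm, Abelianization.of_eq_one_iff.1 ht, (mul_inv_cancel_left _ _).symm⟩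
  · obtain ⟨g, rfl⟩ := Abelianization.of_surjective a
    obtain ⟨x, t, ht, rfl⟩ := h g
    exact ⟨_, _, MonoidHom.isOfFinOrder _ ht, by rw [map_mul, map_pow]⟩

end TorsionFree

/-! ### Comparison of the Bockstein bases. -/

section BocksteinBasis

variable {G : Type*} [Group G]

theorem bocksteinCondition_abelianization_iff [Group.IsNilpotent G] {i : BocksteinIndex}
    (hi : ∀ p, i ≠ .quasiCyclic p) :
    BocksteinCondition (Abelianization G) i ↔ BocksteinCondition G i := by
  cases i with
  | rat => exact torSubgroup_abelianization_eq_top_iff.not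
  | cyclic p => exact isDivisibleBy_abelianization_iff.not
  | quasiCyclic p => exact absurd rfl (hi p)
  | localized p => exact (isLocalAwayFrom_torFreeQuotient_abelianization_iff p.2).not

theorem BocksteinCondition.of_abelianization [Group.IsNilpotent G] {i : BocksteinIndex}
    (h : BocksteinCondition (Abelianization G) i) : BocksteinCondition G i := by
  by_cases hi : ∃ p, i = .quasiCyclic p
  · obtain ⟨p, rfl⟩ := hi
    exact fun hG => h hG.abelianization
  · exact (bocksteinCondition_abelianization_iff (not_exists.1 hi)).1 h

/-- Rests on the Bockstein groups being pairwise non-isomorphic: no other index can produce a copy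
of `ℤ/p^∞`. -/
theorem mem_bocksteinBasisNTD_iff {H : AddCommGrpCat.{0}} :
    H ∈ bocksteinBasisNTD G ↔ ∃ i, (∀ p, i ≠ .quasiCyclic p) ∧
      Nonempty (H ≃+ bocksteinGroup i) ∧ BocksteinCondition G i := by
  constructor
  · rintro ⟨⟨i, hH, hi⟩, hTD⟩
    refine ⟨i, ?_, hH, hi⟩
    rintro p rfl
    exact hTD ⟨⟨_, hH, hi⟩, p, hH⟩
  · rintro ⟨i, hne, ⟨e⟩, hi⟩
    refine ⟨⟨i, ⟨e⟩, hi⟩, ?_⟩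
    rintro ⟨-, p, ⟨e'⟩⟩
    exact hne p (bocksteinGroup_injective (j := .quasiCyclic p) (e.symm.trans e'))

end BocksteinBasis

theorem mainTheorem10 (G : Type*) [Group G] [Group.IsNilpotent G] :
    bocksteinBasisNTD G = bocksteinBasisNTD (Abelianization G) ∧
      bocksteinBasis (Abelianization G) ⊆ bocksteinBasis G := by
  refine ⟨Set.ext fun H => ?_, fun H ⟨i, hH, hi⟩ => ⟨i, hH, hi.of_abelianization⟩⟩
  rw [mem_bocksteinBasisNTD_iff, mem_bocksteinBasisNTD_iff]
  exact exists_congr fun i => and_congr_right fun hi => and_congr_right fun _ =>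
    (bocksteinCondition_abelianization_iff hi).symm
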